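/- **Theorem 1.5.** For natural numbers $s,k,P$ and $\mathbf h=(h_1,\ldots,h_k)\in\mathbb Z^k$, let $U_{s,k}(P;\mathbf h)$ denote the number of integral solutions $(x_1,\ldots,x_s)$ of the system $$\sum_{i=1}^{s}x_i^{2j-1}=h_j\quad(1\le j\le k),\qquad |x_i|\le P\quad(1\le i\le s).$$ Let $k\ge 2$ be an integer. There exist a constant $c>0$ depending only on $k$ and, for each $\varepsilon>0$, a constant $C_\varepsilon>0$ depending only on $k$ and $\varepsilon$, such that the following holds. Let $\eta\in(0,1)$, let $r$ be a non-negative integer, and let $P$ be a positive integer that is sufficiently large in terms of $\eta$, $k$ and $r$. Let $\mathbf h\in\mathbb Z^k$ be arbitrary. (i) If $$U_{k+1,k}(P;\mathbf h)>P^{r+\eta},\qquad(*)$$ then $0\le r\le (k-1)/2$, and there are integers $a_1,\ldots,a_{k-1-2r}$ with $|a_i|\le P$ $(1\le i\le k-1-2r)$ such that $$h_j=a_1^{2j-1}+\cdots+a_{k-1-2r}^{2j-1}\quad(1\le j\le k),$$ where the sum is $0$ if $k-1-2r=0$. (ii) If moreover $r$ is the largest non-negative integer for which $(*)$ holds (for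 these $P$, $\mathbf h$ and $\eta$), then $$c\,P^{r+1}\le U_{k+1,k}(P;\mathbf h)\le C_\varepsilon P^{r+1+\varepsilon}\quad\text{for every }\varepsilon>0.$$ -/

import Mathlib

/-- `oddPowerCount s k P h` is the number of integral solutions `x = (x₁, …, xₛ)` of the system
`x₁ ^ (2j - 1) + ⋯ + xₛ ^ (2j - 1) = h_j` for `1 ≤ j ≤ k`, with `|xᵢ| ≤ P` for all `i`.
The equations are indexed by `j : Fin k`, starting from `0`, so that the exponents
`1, 3, …, 2k - 1` are written `2 * j + 1`. -/
noncomputable def oddPowerCount (s k P : ℕ) (h : Fin k → ℤ) : ℕ :=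
  ((Fintype.piFinset fun _ : Fin s => Finset.Icc (-(P : ℤ)) (P : ℤ)).filter
    fun x => ∀ j : Fin k, ∑ i, x i ^ (2 * (j : ℕ) + 1) = h j).card

/-! A pair `t, -t` contributes nothing to odd power sums. Inserting such a pair multiplies the count
by at least `P`, and deleting one costs a factor `O(P)`. So, up to the solutions with no cancelling
pair, the count is governed by how many pairs can be removed with a solution left over.

Noncancelling solutions are few: `O(1)` in at most `k` variables, `O(P ^ ε)` in `k + 1`. Given two
solutions `x, y`, the vector `z = (x, -y)` has vanishing odd power sums. By Newton's identities `∏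
(X + z i)` is even up to a linear term, so the product of `z j + z i` over `i ≠ j` is a constant `c`
(`prod_erase_add_eq_const`). If `c = 0`, the entries of `y` occur in `x`. Otherwise every `y i + y
j` divides a fixed integer built from `x` (`mem_range_or_add_dvd`), nonzero and polynomially bounded
in `P`, and the divisor bound applies.

A count above `P ^ (r + η)` thus forces a solution in `k + 1 - 2 * (r + 1)` variables, which
supplies the `a i`. -/

/-! ### Newton's identities and the divisibility dichotomy -/

-- In Newton's formula for `n * e_n`, each term `e_a * p_b` has `a + b = n` odd: either `b` is odd
-- and `p_b = 0`, or `a < n` is odd and induction applies.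
open Polynomial in
theorem aeval_esymm_eq_zero_of_odd {ι : Type*} [Fintype ι] (z : ι → ℤ) (k : ℕ)
    (hz : ∀ j < k, ∑ i, z i ^ (2 * j + 1) = 0) (n : ℕ) (hn : Odd n) (hnk : n < 2 * k + 1) :
    MvPolynomial.aeval z (MvPolynomial.esymm ι ℤ n) = 0 := by
  induction n using Nat.strong_induction_on with
  | _ n ih =>
    have h := congrArg (MvPolynomial.aeval z) (MvPolynomial.mul_esymm_eq_sum ι ℤ n)
    simp only [map_mul, map_natCast, map_sum, map_pow, map_neg, map_one] at h
    rw [Finset.sum_eq_zero, mul_zero] at h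
    · rcases mul_eq_zero.1 h with h | h
      · exact absurd (by exact_mod_cast h) hn.pos.ne'
      · exact h
    · intro a ha
      obtain ⟨hsum, hlt⟩ := Finset.mem_filter.1 ha
      replace hsum : a.1 + a.2 = n := Finset.HasAntidiagonal.mem_antidiagonal.1 hsum
      rcases Nat.even_or_odd a.1 with h1 | h1
      · obtain ⟨j, hj⟩ : Odd a.2 := by
          rw [← hsum] at hn
          exact (Nat.odd_add'.1 hn).2 h1
        have := hz j (by omega)
        simp only [MvPolynomial.psum, map_sum, map_pow, MvPolynomial.aeval_X, hj, this, mul_zero]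
      · rw [ih a.1 hlt h1 (by omega), mul_zero, zero_mul]

-- The coefficient of `X ^ d` is `e_(card - d)`, of odd index when `d` is odd. The only index out of
-- Newton's reach is `2 * k + 1`, occurring for `d = 1` and `card = 2 * k + 2`; hence the linear
-- term.
open Polynomial in
theorem prod_X_add_C_sub_comp_neg_X {ι : Type*} [Fintype ι] (z : ι → ℤ) (k : ℕ)
    (hz : ∀ j < k, ∑ i, z i ^ (2 * j + 1) = 0) (heven : Even (Fintype.card ι))
    (hcard : Fintype.card ι ≤ 2 * k + 2) :
    ∃ c : ℤ, (Fintype.card ι ≤ 2 * k → c = 0) ∧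
      (∏ i, (X + C (z i))) - (∏ i, (X + C (z i))).comp (-X) = C (2 * c) * X := by
  set g : ℤ[X] := ∏ i, (X + C (z i)) with hg
  have hcoeff : ∀ d ≤ Fintype.card ι, g.coeff d =
      MvPolynomial.aeval z (MvPolynomial.esymm ι ℤ (Fintype.card ι - d)) := by
    intro d hd
    have hg' : g = ((Finset.univ.val.map z).map fun r => X + C r).prod := by
      rw [Multiset.map_map]; rfl
    rw [hg', Multiset.prod_X_add_C_coeff _ (by simpa using hd),
      MvPolynomial.aeval_esymm_eq_multiset_esymm]
    simp
  have hdeg : ∀ d, Fintype.card ι < d → g.coeff d = 0 := by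
    intro d hd
    apply coeff_eq_zero_of_natDegree_lt
    rw [hg, natDegree_prod_of_monic _ _ fun i _ => monic_X_add_C _]
    simpa only [natDegree_X_add_C, Finset.sum_const, Finset.card_univ, smul_eq_mul, mul_one] using hd
  have hodd : ∀ d, Odd d → d ≠ 1 ∨ Fintype.card ι ≤ 2 * k → g.coeff d = 0 := by
    intro d hd h1
    rcases lt_or_ge (Fintype.card ι) d with h | h
    · exact hdeg d h
    · rw [hcoeff d h]
      refine aeval_esymm_eq_zero_of_odd z k hz _ (Nat.Even.sub_odd h heven hd) ?_
      obtain ⟨a, rfl⟩ := hd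
      omega
  refine ⟨g.coeff 1, fun h => hodd 1 odd_one (Or.inr h), ?_⟩
  ext d
  rw [show (-X : ℤ[X]) = C (-1) * X by simp, coeff_sub, comp_C_mul_X_coeff, coeff_C_mul, coeff_X]
  rcases Nat.even_or_odd d with hd | hd
  · rw [hd.neg_one_pow, if_neg (by rintro rfl; exact absurd hd (by decide))]
    ring
  · rw [hd.neg_one_pow]
    split_ifs with h
    · subst h; ring
    · rw [hodd d hd (Or.inl (Ne.symm h))]; ring

open Polynomial in
/-- If all odd power sums of `z` up to the exponent `2 * k - 1` vanish, then the products
`∏_{i ≠ j} (z j + z i)` do not depend on `j`. -/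
theorem prod_erase_add_eq_const {ι : Type*} [Fintype ι] [DecidableEq ι] (z : ι → ℤ) (k : ℕ)
    (hz : ∀ j < k, ∑ i, z i ^ (2 * j + 1) = 0) (heven : Even (Fintype.card ι))
    (hcard : Fintype.card ι ≤ 2 * k + 2) :
    ∃ c : ℤ, (Fintype.card ι ≤ 2 * k → c = 0) ∧
      ∀ j, ∏ i ∈ Finset.univ.erase j, (z j + z i) = c := by
  obtain ⟨c, hc, h⟩ := prod_X_add_C_sub_comp_neg_X z k hz heven hcard
  refine ⟨c, hc, fun j => ?_⟩
  set q : ℤ[X] := ∏ i ∈ Finset.univ.erase j, (X + C (z i)) with hq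
  have hqj : q.eval (z j) = ∏ i ∈ Finset.univ.erase j, (z j + z i) := by
    simp [hq, eval_prod]
  rw [← hqj]
  rw [← Finset.mul_prod_erase _ _ (Finset.mem_univ j), ← hq] at h
  simp only [mul_comp, add_comp, X_comp, C_comp] at h
  -- The factor `X + z j` vanishes at `-z j`, so evaluating at `z j` gives `2 * z j * q (z j) = 2 *
  -- c * z j`. This is vacuous for `z j = 0`, where `X` must be cancelled before evaluating.
  by_cases h0 : z j = 0
  · rw [h0] at h ⊢
    have h' : X * (q + q.comp (-X)) = X * C (2 * c) := by
      linear_combination h + (-q + q.comp (-X)) * (C_0 : (C 0 : ℤ[X]) = 0)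
    have := congrArg (eval 0) (mul_left_cancel₀ X_ne_zero h')
    simp [eval_comp] at this
    linarith
  · have := congrArg (eval (z j)) h
    simp [eval_comp] at this
    have h2 : (2 * z j) * q.eval (z j) = (2 * z j) * c := by linarith
    exact mul_left_cancel₀ (by simpa using h0) h2

theorem prod_erase_add_mul_prod_sub_eq_const {α : Type*} [Fintype α] [DecidableEq α]
    (x y : α → ℤ) (k : ℕ) (hxy : ∀ j < k, ∑ i, x i ^ (2 * j + 1) = ∑ i, y i ^ (2 * j + 1))
    (hcard : Fintype.card α ≤ k + 1) :
    ∃ c : ℤ, (Fintype.card α ≤ k → c = 0) ∧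
      (∀ j, (∏ i ∈ Finset.univ.erase j, (x j + x i)) * ∏ i, (x j - y i) = c) ∧
      ∀ j, (∏ i, (x i - y j)) * ∏ i ∈ Finset.univ.erase j, (-(y j + y i)) = c := by
  obtain ⟨c, hc, h⟩ := prod_erase_add_eq_const (Sum.elim x fun i => -y i) k
    (fun j hj => by
      simp only [Fintype.sum_sum_type, Sum.elim_inl, Sum.elim_inr, hxy j hj,
        Odd.neg_pow ⟨j, rfl⟩, Finset.sum_neg_distrib, add_neg_cancel])
    (by simp [Fintype.card_sum]) (by rw [Fintype.card_sum]; omega)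
  have hl : ∀ j : α, (Finset.univ : Finset (α ⊕ α)).erase (Sum.inl j) =
      (Finset.univ.erase j).disjSum Finset.univ := by
    intro j; ext (i | i) <;> simp
  have hr : ∀ j : α, (Finset.univ : Finset (α ⊕ α)).erase (Sum.inr j) =
      Finset.univ.disjSum (Finset.univ.erase j) := by
    intro j; ext (i | i) <;> simp
  refine ⟨c, fun h' => hc (by rw [Fintype.card_sum]; omega), fun j => ?_, fun j => ?_⟩
  · rw [← h (Sum.inl j), hl, Finset.prod_disjSum]
    simp [sub_eq_add_neg]
  · rw [← h (Sum.inr j), hr, Finset.prod_disjSum]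
    congr 1 <;> refine Finset.prod_congr rfl fun i _ => ?_ <;> simp <;> ring

/-- Two solutions of the same system without cancelling pairs either share their entries, or
each pairwise sum of one divides the product of all pairwise sums of the other. -/
theorem mem_range_or_add_dvd {α : Type*} [Fintype α] [DecidableEq α]
    (x y : α → ℤ) (k : ℕ) (hxy : ∀ j < k, ∑ i, x i ^ (2 * j + 1) = ∑ i, y i ^ (2 * j + 1))
    (hcard : Fintype.card α ≤ k + 1) (hy : ∀ i j, i ≠ j → y i + y j ≠ 0) :
    (∀ j, ∃ i, x i = y j) ∨ k < Fintype.card α ∧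
      ∀ i j, i ≠ j → y i + y j ∣ ∏ j, ∏ i ∈ Finset.univ.erase j, (x j + x i) := by
  obtain ⟨c, hc, h1, h2⟩ := prod_erase_add_mul_prod_sub_eq_const x y k hxy hcard
  by_cases hc0 : c = 0
  · left
    intro j
    rcases mul_eq_zero.1 ((h2 j).trans hc0) with h | h
    · obtain ⟨i, -, hi⟩ := Finset.prod_eq_zero_iff.1 h
      exact ⟨i, sub_eq_zero.1 hi⟩
    · obtain ⟨i, hi, hi'⟩ := Finset.prod_eq_zero_iff.1 h
      exact absurd (neg_eq_zero.1 hi') (hy j i (Finset.ne_of_mem_erase hi).symm)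
  · right
    refine ⟨not_le.1 fun h => hc0 (hc h), ?_⟩
    have hR : ∏ j, ∏ i, (x j - y i) ≠ 0 := by
      refine Finset.prod_ne_zero_iff.2 fun j _ hj => hc0 ?_
      rw [← h1 j, hj, mul_zero]
    -- Multiplying either side by `∏ (x j - y i)` gives `c ^ card α`.
    have key : (∏ j, ∏ i ∈ Finset.univ.erase j, (x j + x i)) =
        ∏ j, ∏ i ∈ Finset.univ.erase j, (-(y j + y i)) := by
      apply mul_right_cancel₀ hR
      rw [← Finset.prod_mul_distrib, Finset.prod_comm (f := fun j i => x j - y i), mul_comm,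
        ← Finset.prod_mul_distrib]
      exact Finset.prod_congr rfl fun j _ => (h1 j).trans (h2 j).symm
    intro i j hij
    rw [key, ← neg_dvd]
    exact (Finset.dvd_prod_of_mem (fun l => -(y i + y l))
      (Finset.mem_erase.2 ⟨hij.symm, Finset.mem_univ j⟩)).trans
      (Finset.dvd_prod_of_mem (fun i => ∏ l ∈ Finset.univ.erase i, (-(y i + y l)))
        (Finset.mem_univ i))

/-! ### The divisor bound -/

/-- Compare the two sides prime by prime. If `p ≥ 2 ^ (1 / δ)`, then `e + 1 ≤ 2 ^ e ≤ p ^ (e * δ)`;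
each of the at most `B` smaller primes costs a factor `K`. -/
theorem exists_card_divisors_le_mul_rpow (δ : ℝ) (hδ : 0 < δ) :
    ∃ C : ℝ, 1 ≤ C ∧ ∀ n : ℕ, n ≠ 0 → (n.divisors.card : ℝ) ≤ C * (n : ℝ) ^ δ := by
  obtain ⟨B, hB⟩ := exists_nat_ge ((2 : ℝ) ^ (1 / δ))
  set K : ℝ := max 1 (1 / (δ * Real.log 2)) with hK
  have hK1 : 1 ≤ K := le_max_left _ _
  have hlog : 0 < δ * Real.log 2 := mul_pos hδ (Real.log_pos one_lt_two)
  have hK2 : 1 ≤ K * (δ * Real.log 2) := by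
    rw [← div_le_iff₀ hlog]; exact le_max_right _ _
  have hpow : ∀ p : ℕ, p.Prime → ∀ e : ℕ,
      (e + 1 : ℝ) ≤ (if p < B then K else 1) * ((p : ℝ) ^ e) ^ δ := by
    intro p hp e
    have hp2 : (2 : ℝ) ≤ p := by exact_mod_cast hp.two_le
    have hcomm : ((p : ℝ) ^ e) ^ δ = ((p : ℝ) ^ δ) ^ e := by
      rw [← Real.rpow_natCast, ← Real.rpow_mul (by positivity), mul_comm,
        Real.rpow_mul (by positivity), Real.rpow_natCast]
    split_ifs with h
    · have h2 : 1 + (e : ℝ) * (δ * Real.log 2) ≤ ((p : ℝ) ^ e) ^ δ := by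
        calc 1 + (e : ℝ) * (δ * Real.log 2) ≤ Real.exp ((e : ℝ) * (δ * Real.log 2)) := by
              linarith [Real.add_one_le_exp ((e : ℝ) * (δ * Real.log 2))]
          _ = ((2 : ℝ) ^ e) ^ δ := by
              rw [← Real.rpow_natCast, ← Real.rpow_mul (by positivity),
                Real.rpow_def_of_pos two_pos]
              congr 1; ring
          _ ≤ ((p : ℝ) ^ e) ^ δ := by gcongr
      calc (e + 1 : ℝ) ≤ K * (1 + (e : ℝ) * (δ * Real.log 2)) := by
            have := mul_le_mul_of_nonneg_left hK2 (Nat.cast_nonneg (α := ℝ) e)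
            nlinarith
        _ ≤ _ := by gcongr
    · have hBp : (B : ℝ) ≤ p := by exact_mod_cast not_lt.1 h
      have h2 : (2 : ℝ) ≤ (p : ℝ) ^ δ := by
        calc (2 : ℝ) = ((2 : ℝ) ^ (1 / δ)) ^ δ := by
              rw [← Real.rpow_mul (by positivity), one_div_mul_cancel hδ.ne', Real.rpow_one]
          _ ≤ (p : ℝ) ^ δ := by gcongr; exact hB.trans hBp
      rw [one_mul, hcomm]
      calc (e + 1 : ℝ) ≤ (2 : ℝ) ^ e := by exact_mod_cast Nat.lt_two_pow_self
        _ ≤ _ := by gcongr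
  refine ⟨K ^ B, one_le_pow₀ hK1, fun n hn => ?_⟩
  rw [Nat.card_divisors hn]
  push_cast
  calc ∏ p ∈ n.primeFactors, ((n.factorization p : ℝ) + 1)
      ≤ ∏ p ∈ n.primeFactors,
          ((if p < B then K else 1) * ((p : ℝ) ^ n.factorization p) ^ δ) :=
        Finset.prod_le_prod (fun _ _ => by positivity)
          fun p hp => hpow p (Nat.prime_of_mem_primeFactors hp) _
    _ = (∏ p ∈ n.primeFactors, (if p < B then K else 1)) * (n : ℝ) ^ δ := by
        rw [Finset.prod_mul_distrib, Real.finsetProd_rpow _ _ (fun _ _ => by positivity)]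
        congr 2
        exact_mod_cast Nat.prod_factorization_pow_eq_self hn
    _ ≤ K ^ B * (n : ℝ) ^ δ := by
        gcongr
        rw [Finset.prod_ite, Finset.prod_const, Finset.prod_const_one, mul_one]
        refine pow_le_pow_right₀ hK1 ?_
        calc _ ≤ (Finset.range B).card := Finset.card_le_card fun p hp => by
              simpa using (Finset.mem_filter.1 hp).2
          _ = B := Finset.card_range B

/-! ### Counting noncancelling solutions -/

/-- The solutions counted by `oddPowerCount`. -/
noncomputable def oddPowerSolutions (s k P : ℕ) (h : Fin k → ℤ) : Finset (Fin s → ℤ) :=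
  (Fintype.piFinset fun _ : Fin s => Finset.Icc (-(P : ℤ)) (P : ℤ)).filter
    fun x => ∀ j : Fin k, ∑ i, x i ^ (2 * (j : ℕ) + 1) = h j

theorem card_oddPowerSolutions (s k P : ℕ) (h : Fin k → ℤ) :
    (oddPowerSolutions s k P h).card = oddPowerCount s k P h := rfl

theorem mem_oddPowerSolutions {s k P : ℕ} {h : Fin k → ℤ} {x : Fin s → ℤ} :
    x ∈ oddPowerSolutions s k P h ↔
      (∀ i, |x i| ≤ P) ∧ ∀ j : Fin k, ∑ i, x i ^ (2 * (j : ℕ) + 1) = h j := by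
  simp [oddPowerSolutions, abs_le, Fintype.mem_piFinset]

open Classical in
/-- The solutions without cancelling pairs. -/
noncomputable def noncancellingSolutions (s k P : ℕ) (h : Fin k → ℤ) : Finset (Fin s → ℤ) :=
  (oddPowerSolutions s k P h).filter fun x => ∀ i j, i ≠ j → x i + x j ≠ 0

theorem mem_noncancellingSolutions {s k P : ℕ} {h : Fin k → ℤ} {x : Fin s → ℤ} :
    x ∈ noncancellingSolutions s k P h ↔
      x ∈ oddPowerSolutions s k P h ∧ ∀ i j, i ≠ j → x i + x j ≠ 0 := by
  simp [noncancellingSolutions]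

theorem sum_pow_eq_of_mem_oddPowerSolutions {s k P : ℕ} {h : Fin k → ℤ} {x y : Fin s → ℤ}
    (hx : x ∈ oddPowerSolutions s k P h) (hy : y ∈ oddPowerSolutions s k P h) :
    ∀ j < k, ∑ i, x i ^ (2 * j + 1) = ∑ i, y i ^ (2 * j + 1) := fun j hj =>
  ((mem_oddPowerSolutions.1 hx).2 ⟨j, hj⟩).trans ((mem_oddPowerSolutions.1 hy).2 ⟨j, hj⟩).symm

theorem card_piFinset_image_le {s : ℕ} (x : Fin s → ℤ) :
    (Fintype.piFinset fun _ : Fin s => Finset.univ.image x).card ≤ s ^ s := by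
  rw [Fintype.card_piFinset, Finset.prod_const, Finset.card_univ, Fintype.card_fin]
  exact Nat.pow_le_pow_left (Finset.card_image_le.trans (by simp)) _

/-- With `s ≤ k` the constant `c` is zero, so every solution takes its entries from one fixed
solution. -/
theorem card_noncancellingSolutions_le {s k : ℕ} (hsk : s ≤ k) (P : ℕ) (h : Fin k → ℤ) :
    (noncancellingSolutions s k P h).card ≤ s ^ s := by
  rcases (noncancellingSolutions s k P h).eq_empty_or_nonempty with he | ⟨x, hx⟩
  · simp [he]
  refine (Finset.card_le_card fun y hy => ?_).trans (card_piFinset_image_le x)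
  rw [mem_noncancellingSolutions] at hx hy
  rcases mem_range_or_add_dvd x y k (sum_pow_eq_of_mem_oddPowerSolutions hx.1 hy.1)
    (by simpa using hsk.trans k.le_succ) hy.2 with h | h
  · simpa [Fintype.mem_piFinset] using h
  · exact absurd h.1 (by simpa using hsk)

/-- A vector of length at least three is determined by its pairwise sums. -/
theorem eq_of_forall_add_eq {s : ℕ} (hs : 3 ≤ s) {x y : Fin s → ℤ}
    (h : ∀ i j, i ≠ j → x i + x j = y i + y j) : x = y := by
  funext l
  obtain ⟨i, hi⟩ := Finset.exists_mem_notMem_of_card_lt_card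
    (s := {l}) (t := (Finset.univ : Finset (Fin s))) (by simp; omega)
  obtain ⟨j, hj⟩ := Finset.exists_mem_notMem_of_card_lt_card
    (s := {l, i}) (t := (Finset.univ : Finset (Fin s)))
    ((Finset.card_le_two).trans_lt (by simp; omega))
  simp only [Finset.mem_univ, Finset.mem_singleton, Finset.mem_insert, true_and, not_or] at hi hj
  have h1 := h l i (Ne.symm hi)
  have h2 := h l j (Ne.symm hj.1)
  have h3 := h i j (Ne.symm hj.2)
  linarith

theorem card_filter_forall_add_dvd_le {s : ℕ} (hs : 3 ≤ s) {M : ℤ} (hM : M ≠ 0)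
    (A : Finset (Fin s → ℤ)) (hA : ∀ y ∈ A, ∀ i j, i ≠ j → y i + y j ∣ M) :
    A.card ≤ (2 * M.natAbs.divisors.card) ^ (s * s) := by
  classical
  set D : Finset ℤ := M.natAbs.divisors.image (fun d : ℕ => (d : ℤ)) ∪
    M.natAbs.divisors.image (fun d : ℕ => -(d : ℤ)) with hD
  have hDcard : D.card ≤ 2 * M.natAbs.divisors.card := by
    rw [two_mul]
    exact (Finset.card_union_le _ _).trans (add_le_add Finset.card_image_le Finset.card_image_le)
  have hDmem : ∀ d : ℤ, d ∣ M → d ∈ D := by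
    intro d hd
    have hd' : d.natAbs ∈ M.natAbs.divisors :=
      Nat.mem_divisors.2 ⟨Int.natAbs_dvd_natAbs.2 hd, by simpa using hM⟩
    rw [hD, Finset.mem_union, Finset.mem_image, Finset.mem_image]
    rcases Int.natAbs_eq d with h | h
    · exact Or.inl ⟨_, hd', h.symm⟩
    · exact Or.inr ⟨_, hd', h.symm⟩
  have : A.card ≤ (Fintype.piFinset fun _ : Fin s × Fin s => D).card := by
    -- The diagonal carries no information; `1` is a filler that always divides `M`.
    refine Finset.card_le_card_of_injOn (fun y p => if p.1 = p.2 then 1 else y p.1 + y p.2) ?_ ?_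
    · intro y hy
      simp only [Finset.mem_coe, Fintype.mem_piFinset]
      intro p
      split_ifs with hp
      · exact hDmem 1 (one_dvd M)
      · exact hDmem _ (hA y hy _ _ hp)
    · intro x _ y _ hxy
      refine eq_of_forall_add_eq hs fun i j hij => ?_
      simpa [hij] using congrFun hxy (i, j)
  refine this.trans ?_
  rw [Fintype.card_piFinset, Finset.prod_const, Finset.card_univ, Fintype.card_prod,
    Fintype.card_fin]
  exact Nat.pow_le_pow_left hDcard _

theorem natAbs_prod_prod_add_le {s P : ℕ} (hP : 1 ≤ P) (x : Fin s → ℤ) (hx : ∀ i, |x i| ≤ P) :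
    (∏ j, ∏ i ∈ Finset.univ.erase j, (x j + x i)).natAbs ≤ (2 * P) ^ (s * s) := by
  have hfac : ∀ i j, (x j + x i).natAbs ≤ 2 * P := by
    intro i j
    have h1 := abs_le.1 (hx i)
    have h2 := abs_le.1 (hx j)
    omega
  have habs : ∀ (t : Finset (Fin s)) (f : Fin s → ℤ) (B : ℕ), 1 ≤ B → (∀ i, (f i).natAbs ≤ B) →
      (∏ i ∈ t, f i).natAbs ≤ B ^ s := by
    intro t f B hB hf
    rw [show (∏ i ∈ t, f i).natAbs = ∏ i ∈ t, (f i).natAbs from map_prod Int.natAbsHom f t]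
    refine (Finset.prod_le_pow_card _ _ _ fun i _ => hf i).trans
      (Nat.pow_le_pow_right hB ?_)
    simpa using Finset.card_le_univ t
  rw [pow_mul]
  exact habs _ _ _ (Nat.one_le_pow _ _ (by omega)) fun j => habs _ _ _ (by omega) fun i => hfac i j

theorem exists_card_noncancellingSolutions_le_rpow {s k : ℕ} (hs : 3 ≤ s) (hsk : s ≤ k + 1)
    (δ : ℝ) (hδ : 0 < δ) : ∃ C : ℝ, 0 < C ∧ ∀ P : ℕ, 1 ≤ P → ∀ h : Fin k → ℤ,
      ((noncancellingSolutions s k P h).card : ℝ) ≤ C * (P : ℝ) ^ δ := by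
  classical
  have hs0 : (0 : ℝ) < s := by exact_mod_cast (by omega : 0 < s)
  set m : ℕ := s * s with hm
  have hm0 : (0 : ℝ) < m := by rw [hm]; push_cast; positivity
  -- Here `|M| ≤ (2 * P) ^ m`, and the divisor count is raised to the power `m`, so the exponent
  -- `δ'` is multiplied by `m * m`.
  set δ' : ℝ := δ / (m * m) with hδ'
  have hδ'0 : 0 < δ' := by positivity
  obtain ⟨C, hC1, hC⟩ := exists_card_divisors_le_mul_rpow δ' hδ'0
  set K : ℝ := (2 * C) ^ m * (2 : ℝ) ^ δ with hK
  have hK0 : 0 ≤ K := by positivity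
  refine ⟨(s : ℝ) ^ s + K, by positivity, fun P hP h => ?_⟩
  have hP1 : (1 : ℝ) ≤ P := by exact_mod_cast hP
  have hPδ : 1 ≤ (P : ℝ) ^ δ := Real.one_le_rpow hP1 hδ.le
  rcases (noncancellingSolutions s k P h).eq_empty_or_nonempty with he | ⟨x, hx⟩
  · rw [he, Finset.card_empty, Nat.cast_zero]; positivity
  rw [mem_noncancellingSolutions] at hx
  set M : ℤ := ∏ j, ∏ i ∈ Finset.univ.erase j, (x j + x i) with hMdef
  have hM0 : M ≠ 0 := Finset.prod_ne_zero_iff.2 fun j _ => Finset.prod_ne_zero_iff.2 fun i hi =>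
    hx.2 j i (Finset.ne_of_mem_erase hi).symm
  set A := (noncancellingSolutions s k P h).filter fun y => ∀ i j, i ≠ j → y i + y j ∣ M with hA
  have hsub : noncancellingSolutions s k P h ⊆
      (Fintype.piFinset fun _ : Fin s => Finset.univ.image x) ∪ A := by
    intro y hy
    have hy' := mem_noncancellingSolutions.1 hy
    rw [Finset.mem_union]
    rcases mem_range_or_add_dvd x y k (sum_pow_eq_of_mem_oddPowerSolutions hx.1 hy'.1)
      (by simpa using hsk) hy'.2 with h | h
    · left; simpa [Fintype.mem_piFinset] using h
    · exact Or.inr (Finset.mem_filter.2 ⟨hy, h.2⟩)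
  have hAcard := card_filter_forall_add_dvd_le hs hM0 A fun y hy => (Finset.mem_filter.1 hy).2
  have hcard := ((Finset.card_le_card hsub).trans (Finset.card_union_le _ _)).trans
    (add_le_add (card_piFinset_image_le x) hAcard)
  have hMle : (M.natAbs : ℝ) ≤ (2 * P : ℝ) ^ m := by
    exact_mod_cast natAbs_prod_prod_add_le hP x (mem_oddPowerSolutions.1 hx.1).1
  have hdiv : (M.natAbs.divisors.card : ℝ) ≤ C * (2 * P : ℝ) ^ (m * δ') := by
    refine (hC _ (by simpa using hM0)).trans ?_
    rw [Real.rpow_mul (by positivity), Real.rpow_natCast]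
    gcongr
  have hpow : ((2 * M.natAbs.divisors.card : ℕ) : ℝ) ^ m ≤ K * (P : ℝ) ^ δ := by
    calc ((2 * M.natAbs.divisors.card : ℕ) : ℝ) ^ m
        ≤ (2 * (C * (2 * P : ℝ) ^ (m * δ'))) ^ m := by push_cast; gcongr
      _ = (2 * C) ^ m * (2 * P : ℝ) ^ δ := by
          rw [← mul_assoc, mul_pow, ← Real.rpow_natCast ((2 * P : ℝ) ^ (m * δ')),
            ← Real.rpow_mul (by positivity)]
          congr 2
          rw [hδ']; field_simp
      _ = K * (P : ℝ) ^ δ := by rw [Real.mul_rpow two_pos.le (by positivity), hK, mul_assoc]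
  calc ((noncancellingSolutions s k P h).card : ℝ)
      ≤ (s : ℝ) ^ s + ((2 * M.natAbs.divisors.card : ℕ) : ℝ) ^ m := by exact_mod_cast hcard
    _ ≤ (s : ℝ) ^ s * (P : ℝ) ^ δ + K * (P : ℝ) ^ δ := by
        gcongr
        exact le_mul_of_one_le_right (by positivity) hPδ
    _ = _ := by ring

/-! ### Deleting and inserting cancelling pairs -/

theorem card_filter_add_eq_zero_le (n k P : ℕ) (h : Fin k → ℤ) (i : Fin (n + 2))
    (j : Fin (n + 1)) :
    ((oddPowerSolutions (n + 2) k P h).filter fun y => y i + y (i.succAbove j) = 0).card ≤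
      (2 * P + 1) * oddPowerCount n k P h := by
  have hcard : (Finset.Icc (-(P : ℤ)) P ×ˢ oddPowerSolutions n k P h).card =
      (2 * P + 1) * oddPowerCount n k P h := by
    rw [Finset.card_product, Int.card_Icc, card_oddPowerSolutions]
    congr 1; omega
  rw [← hcard]
  refine Finset.card_le_card_of_injOn
    (fun y => (y i, fun l => y (i.succAbove (j.succAbove l)))) ?_ ?_
  · intro y hy
    obtain ⟨hy, hij⟩ := Finset.mem_filter.1 hy
    rw [mem_oddPowerSolutions] at hy
    rw [Finset.mem_coe, Finset.mem_product, mem_oddPowerSolutions]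
    refine ⟨Finset.mem_Icc.2 (abs_le.1 (hy.1 i)), fun l => hy.1 _, fun e => ?_⟩
    rw [← hy.2 e, Fin.sum_univ_succAbove _ i, Fin.sum_univ_succAbove _ j,
      eq_neg_of_add_eq_zero_left hij, Odd.neg_pow ⟨e, rfl⟩, neg_add_cancel_left]
  · intro x hx y hy hxy
    have hx' := (Finset.mem_filter.1 hx).2
    have hy' := (Finset.mem_filter.1 hy).2
    obtain ⟨h1, h2⟩ := Prod.mk.inj hxy
    funext l
    rcases Fin.eq_self_or_eq_succAbove i l with rfl | ⟨l, rfl⟩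
    · exact h1
    rcases Fin.eq_self_or_eq_succAbove j l with rfl | ⟨l, rfl⟩
    · linarith
    · exact congrFun h2 l

theorem oddPowerCount_add_two_le (n k P : ℕ) (h : Fin k → ℤ) :
    oddPowerCount (n + 2) k P h ≤ (noncancellingSolutions (n + 2) k P h).card +
      (n + 2) * (n + 1) * ((2 * P + 1) * oddPowerCount n k P h) := by
  classical
  have hsub : oddPowerSolutions (n + 2) k P h ⊆ noncancellingSolutions (n + 2) k P h ∪
      (Finset.univ : Finset (Fin (n + 2) × Fin (n + 1))).biUnion fun p =>
        (oddPowerSolutions (n + 2) k P h).filter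
          fun y => y p.1 + y (p.1.succAbove p.2) = 0 := by
    intro y hy
    rw [Finset.mem_union, mem_noncancellingSolutions, or_iff_not_imp_left]
    intro hne
    push Not at hne
    obtain ⟨i, j, hij, h0⟩ := hne hy
    obtain ⟨j, rfl⟩ := Fin.exists_succAbove_eq hij.symm
    exact Finset.mem_biUnion.2 ⟨(i, j), Finset.mem_univ _, Finset.mem_filter.2 ⟨hy, h0⟩⟩
  rw [← card_oddPowerSolutions]
  refine ((Finset.card_le_card hsub).trans (Finset.card_union_le _ _)).trans
    (Nat.add_le_add_left ?_ _)
  refine (Finset.card_biUnion_le_card_mul _ _ _ fun p _ =>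
    card_filter_add_eq_zero_le n k P h p.1 p.2).trans_eq ?_
  simp

theorem noncancellingSolutions_eq_of_lt_two {s : ℕ} (hs : s < 2) (k P : ℕ) (h : Fin k → ℤ) :
    noncancellingSolutions s k P h = oddPowerSolutions s k P h := by
  ext x
  rw [mem_noncancellingSolutions]
  exact and_iff_left fun i j hij => absurd (Fin.ext (by omega)) hij

theorem mul_oddPowerCount_le (n k P : ℕ) (h : Fin k → ℤ) :
    P * oddPowerCount n k P h ≤ oddPowerCount (n + 2) k P h := by
  have hcard : (Finset.Icc (1 : ℤ) P ×ˢ oddPowerSolutions n k P h).card =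
      P * oddPowerCount n k P h := by
    rw [Finset.card_product, Int.card_Icc, card_oddPowerSolutions]
    congr 1; omega
  rw [← hcard, ← card_oddPowerSolutions]
  refine Finset.card_le_card_of_injOn
    (fun p => (Fin.cons p.1 (Fin.cons (-p.1) p.2 : Fin (n + 1) → ℤ) : Fin (n + 2) → ℤ)) ?_ ?_
  · rintro ⟨t, x⟩ hp
    obtain ⟨ht, hx⟩ := Finset.mem_product.1 hp
    rw [mem_oddPowerSolutions] at hx
    have ht' : |t| ≤ P := by
      have := Finset.mem_Icc.1 ht
      exact abs_le.2 ⟨by simp at this; omega, this.2⟩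
    rw [Finset.mem_coe, mem_oddPowerSolutions]
    refine ⟨?_, fun e => ?_⟩
    · simp only [Fin.forall_fin_succ (n := n + 1),
        Fin.forall_fin_succ (n := n), Fin.cons_zero, Fin.cons_succ, abs_neg]
      exact ⟨ht', ht', hx.1⟩
    · rw [← hx.2 e, Fin.sum_univ_succ, Fin.sum_univ_succ]
      simp only [Fin.cons_zero, Fin.cons_succ]
      rw [Odd.neg_pow ⟨e, rfl⟩, add_neg_cancel_left]
  · rintro ⟨t, x⟩ _ ⟨t', x'⟩ _ hxy
    obtain ⟨h1, h2⟩ := Fin.cons_inj.1 hxy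
    exact Prod.ext h1 (Fin.cons_inj.1 h2).2

theorem pow_mul_oddPowerCount_le (n m k P : ℕ) (h : Fin k → ℤ) :
    P ^ m * oddPowerCount n k P h ≤ oddPowerCount (n + 2 * m) k P h := by
  induction m with
  | zero => simp
  | succ m ih =>
    calc P ^ (m + 1) * oddPowerCount n k P h = P * (P ^ m * oddPowerCount n k P h) := by ring
      _ ≤ P * oddPowerCount (n + 2 * m) k P h := Nat.mul_le_mul_left _ ih
      _ ≤ _ := mul_oddPowerCount_le _ _ _ _

/-! ### Upper bounds by removing pairs -/

/-- If no solution in `s ≤ k` variables contains more than `m` cancelling pairs, then there are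
`O(P ^ m)` solutions. -/
theorem exists_oddPowerCount_le_mul_pow (s k : ℕ) (hsk : s ≤ k) :
    ∃ K : ℕ, ∀ P : ℕ, 1 ≤ P → ∀ (h : Fin k → ℤ) (m : ℕ),
      (2 * (m + 1) ≤ s → oddPowerCount (s - 2 * (m + 1)) k P h = 0) →
      oddPowerCount s k P h ≤ K * P ^ m := by
  induction s using Nat.strong_induction_on with
  | _ s ih =>
    rcases lt_or_ge s 2 with hs | hs
    · refine ⟨s ^ s, fun P hP h m _ => ?_⟩
      rw [← card_oddPowerSolutions, ← noncancellingSolutions_eq_of_lt_two hs]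
      exact (card_noncancellingSolutions_le hsk P h).trans
        (Nat.le_mul_of_pos_right _ (Nat.pow_pos hP))
    obtain ⟨n, rfl⟩ := Nat.exists_eq_add_of_le' hs
    obtain ⟨K, hK⟩ := ih n (by omega) (by omega)
    refine ⟨(n + 2) ^ (n + 2) + (n + 2) * (n + 1) * (3 * K), fun P hP h m hm => ?_⟩
    have h1 := oddPowerCount_add_two_le n k P h
    have h2 := card_noncancellingSolutions_le hsk P h
    cases m with
    | zero =>
      rw [show n + 2 - 2 * (0 + 1) = n by omega] at hm
      rw [hm (by omega)] at h1
      simp only [mul_zero, add_zero, pow_zero, mul_one] at h1 ⊢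
      exact h1.trans (h2.trans (Nat.le_add_right _ _))
    | succ m =>
      have h3 := hK P hP h m fun hle => by
        rw [show n - 2 * (m + 1) = n + 2 - 2 * (m + 1 + 1) by omega]
        exact hm (by omega)
      calc oddPowerCount (n + 2) k P h
          ≤ (n + 2) ^ (n + 2) * P ^ (m + 1) +
            (n + 2) * (n + 1) * ((3 * P) * (K * P ^ m)) := by
            refine h1.trans (add_le_add ?_ ?_)
            · exact h2.trans (Nat.le_mul_of_pos_right _ (Nat.pow_pos hP))
            · exact Nat.mul_le_mul_left _ (Nat.mul_le_mul (by omega) h3)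
        _ = _ := by ring

/-- If no solution in `k + 1` variables contains more than `m` cancelling pairs, then there are
`O(P ^ (m + ε))` solutions. -/
theorem exists_oddPowerCount_le_mul_rpow (k : ℕ) (hk : 2 ≤ k) (ε : ℝ) (hε : 0 < ε) :
    ∃ C : ℝ, 0 < C ∧ ∀ P : ℕ, 1 ≤ P → ∀ (h : Fin k → ℤ) (m : ℕ),
      (2 * (m + 1) ≤ k + 1 → oddPowerCount (k + 1 - 2 * (m + 1)) k P h = 0) →
      (oddPowerCount (k + 1) k P h : ℝ) ≤ C * (P : ℝ) ^ ((m : ℝ) + ε) := by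
  obtain ⟨n, rfl⟩ := Nat.exists_eq_add_of_le' (show 1 ≤ k by omega)
  obtain ⟨C, hC0, hC⟩ := exists_card_noncancellingSolutions_le_rpow (s := n + 2) (k := n + 1)
    (by omega) le_rfl ε hε
  obtain ⟨K, hK⟩ := exists_oddPowerCount_le_mul_pow n (n + 1) (by omega)
  refine ⟨C + (n + 2) * (n + 1) * (3 * K), by positivity, fun P hP h m hm => ?_⟩
  have hP1 : (1 : ℝ) ≤ P := by exact_mod_cast hP
  have h1 : (oddPowerCount (n + 2) (n + 1) P h : ℝ) ≤
      (noncancellingSolutions (n + 2) (n + 1) P h).card +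
      (n + 2) * (n + 1) * ((2 * P + 1) * oddPowerCount n (n + 1) P h) := by
    exact_mod_cast oddPowerCount_add_two_le n (n + 1) P h
  have h2 := hC P hP h
  have hPε : (P : ℝ) ^ ε ≤ (P : ℝ) ^ ((m : ℝ) + ε) :=
    Real.rpow_le_rpow_of_exponent_le hP1 (le_add_of_nonneg_left (Nat.cast_nonneg m))
  have h3 : (2 * (P : ℝ) + 1) * oddPowerCount n (n + 1) P h ≤
      3 * K * (P : ℝ) ^ ((m : ℝ) + ε) := by
    cases m with
    | zero =>
      rw [show n + 1 + 1 - 2 * (0 + 1) = n by omega] at hm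
      rw [hm (by omega)]
      simp only [Nat.cast_zero, mul_zero]
      positivity
    | succ m =>
      have h3 : (oddPowerCount n (n + 1) P h : ℝ) ≤ K * (P : ℝ) ^ m := by
        exact_mod_cast hK P hP h m fun hle => by
          rw [show n - 2 * (m + 1) = n + 1 + 1 - 2 * (m + 1 + 1) by omega]
          exact hm (by omega)
      calc (2 * (P : ℝ) + 1) * oddPowerCount n (n + 1) P h
          ≤ (3 * P) * (K * (P : ℝ) ^ m) := by gcongr; linarith
        _ = 3 * K * (P : ℝ) ^ (((m + 1 : ℕ)) : ℝ) := by rw [Real.rpow_natCast]; ring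
        _ ≤ _ := by
          gcongr
          linarith
  calc (oddPowerCount (n + 2) (n + 1) P h : ℝ)
      ≤ C * (P : ℝ) ^ ((m : ℝ) + ε) +
        (n + 2) * (n + 1) * (3 * K * (P : ℝ) ^ ((m : ℝ) + ε)) := by
        refine h1.trans (add_le_add (h2.trans ?_) ?_) <;> gcongr
    _ = _ := by ring

/-! ### Conclusion -/

/-- Contrapositive of the upper bound with `ε = η / 2`; the spare `P ^ (η / 2)` absorbs the
constant, uniformly in `r`. -/
theorem le_and_ne_zero_of_lt_oddPowerCount (k : ℕ) (hk : 2 ≤ k) (η : ℝ) (hη : 0 < η) :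
    ∃ P₀ : ℕ, ∀ P : ℕ, P₀ ≤ P → ∀ (h : Fin k → ℤ) (r : ℕ),
      (P : ℝ) ^ ((r : ℝ) + η) < oddPowerCount (k + 1) k P h →
      2 * (r + 1) ≤ k + 1 ∧ oddPowerCount (k + 1 - 2 * (r + 1)) k P h ≠ 0 := by
  obtain ⟨C, hC0, hC⟩ := exists_oddPowerCount_le_mul_rpow k hk (η / 2) (half_pos hη)
  obtain ⟨P₁, hP₁⟩ := Filter.eventually_atTop.1
    (((tendsto_rpow_atTop (half_pos hη)).comp tendsto_natCast_atTop_atTop).eventually_ge_atTop C)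
  refine ⟨max P₁ 1, fun P hP h r hlt => ?_⟩
  have hP0 : (0 : ℝ) < P := by exact_mod_cast (le_max_right P₁ 1).trans hP
  have hCP : C ≤ (P : ℝ) ^ (η / 2) := hP₁ P ((le_max_left _ _).trans hP)
  by_contra hcon
  refine absurd hlt (not_lt.2 ?_)
  refine (hC P ((le_max_right _ _).trans hP) h r fun hle => by_contra fun hne => hcon ⟨hle, hne⟩).trans ?_
  calc C * (P : ℝ) ^ ((r : ℝ) + η / 2)
      ≤ (P : ℝ) ^ (η / 2) * (P : ℝ) ^ ((r : ℝ) + η / 2) := by gcongr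
    _ = (P : ℝ) ^ ((r : ℝ) + η) := by rw [← Real.rpow_add hP0]; congr 1; ring

theorem theorem1p5 (k : ℕ) (hk : 2 ≤ k) :
    ∃ c : ℝ, 0 < c ∧ ∃ C : ℝ → ℝ, (∀ ε : ℝ, 0 < ε → 0 < C ε) ∧
      ∀ η : ℝ, 0 < η → η < 1 → ∀ r : ℕ, ∃ P₀ : ℕ, ∀ P : ℕ, P₀ ≤ P → ∀ h : Fin k → ℤ,
        ((oddPowerCount (k + 1) k P h : ℝ) > (P : ℝ) ^ ((r : ℝ) + η) →
          (r : ℝ) ≤ ((k : ℝ) - 1) / 2 ∧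
          ∃ a : Fin (k - 1 - 2 * r) → ℤ, (∀ i, |a i| ≤ (P : ℤ)) ∧
            ∀ j : Fin k, h j = ∑ i, a i ^ (2 * (j : ℕ) + 1)) ∧
        (IsGreatest {s : ℕ | (oddPowerCount (k + 1) k P h : ℝ) > (P : ℝ) ^ ((s : ℝ) + η)} r →
          c * (P : ℝ) ^ (r + 1) ≤ (oddPowerCount (k + 1) k P h : ℝ) ∧
          ∀ ε : ℝ, 0 < ε → (oddPowerCount (k + 1) k P h : ℝ) ≤ C ε * (P : ℝ) ^ ((r : ℝ) + 1 + ε)) := by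
  choose! C hC0 hC using exists_oddPowerCount_le_mul_rpow k hk
  refine ⟨1, one_pos, C, hC0, fun η hη hη1 r => ?_⟩
  obtain ⟨P₁, hP₁⟩ := le_and_ne_zero_of_lt_oddPowerCount k hk η hη
  refine ⟨max P₁ 2, fun P hP h => ?_⟩
  have hP2 : 2 ≤ P := (le_max_right _ _).trans hP
  have hP2' : (1 : ℝ) < P := by exact_mod_cast hP2
  have hlow : ∀ m : ℕ, 2 * m ≤ k + 1 → oddPowerCount (k + 1 - 2 * m) k P h ≠ 0 →
      (P : ℝ) ^ m ≤ oddPowerCount (k + 1) k P h := by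
    intro m hm hne
    have := pow_mul_oddPowerCount_le (k + 1 - 2 * m) m k P h
    rw [Nat.sub_add_cancel hm] at this
    exact_mod_cast (Nat.le_mul_of_pos_right _ (Nat.pos_of_ne_zero hne)).trans this
  refine ⟨fun hlt => ?_, fun hr => ⟨?_, fun ε hε => ?_⟩⟩
  · obtain ⟨hle, hne⟩ := hP₁ P ((le_max_left _ _).trans hP) h r hlt
    refine ⟨?_, ?_⟩
    · have : (2 * (r + 1) : ℝ) ≤ k + 1 := by exact_mod_cast hle
      linarith
    · rw [show k + 1 - 2 * (r + 1) = k - 1 - 2 * r by omega, ← card_oddPowerSolutions,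
        Finset.card_ne_zero] at hne
      obtain ⟨a, ha⟩ := hne
      rw [mem_oddPowerSolutions] at ha
      exact ⟨a, ha.1, fun j => (ha.2 j).symm⟩
  · obtain ⟨hle, hne⟩ := hP₁ P ((le_max_left _ _).trans hP) h r hr.1
    rw [one_mul]
    exact hlow (r + 1) hle hne
  -- A solution left after removing `r + 2` pairs would give a count of at least `P ^ (r + 2) > P ^
  -- (r + 1 + η)`, as `η < 1`, against the maximality of `r`.
  · have := hC ε hε P (by omega) h (r + 1) fun hle => by
      by_contra hne
      have hmem : (r + 1) ∈
          {s : ℕ | (oddPowerCount (k + 1) k P h : ℝ) > (P : ℝ) ^ ((s : ℝ) + η)} := by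
        refine lt_of_lt_of_le ?_ (hlow (r + 1 + 1) hle hne)
        rw [← Real.rpow_natCast]
        refine Real.rpow_lt_rpow_of_exponent_lt hP2' ?_
        push_cast
        linarith
      exact absurd (hr.2 hmem) (by omega)
    exact_mod_cast this
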